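/- Let $\mathbb H$ be the real quaternions and $n\ge 0$. Let $\mathbb H[q_1,\dots,q_n]$ be the ring of slice regular polynomials $P=\sum_{\ell} q_1^{\ell_1}\cdots q_n^{\ell_n}a_\ell$ with $a_\ell\in\mathbb H$, with the slice product given by additivity from $$(q_1^{m_1}\cdots q_n^{m_n}a)*(q_1^{l_1}\cdots q_n^{l_n}b)=q_1^{m_1+l_1}\cdots q_n^{m_n+l_n}\,ab .$$ For $P=\sum_\ell q_1^{\ell_1}\cdots q_n^{\ell_n}a_\ell$ put $P^c=\sum_\ell q_1^{\ell_1}\cdots q_n^{\ell_n}\overline{a_\ell}$ and $P^s=P*P^c$. A right ideal $J$ is called *completely prime* if $P*Q\in J$ and $P*J\subseteq J$ imply $P\in J$ or $Q\in J$; it is called *quasi prime* if $P*Q\in J$ implies $P\in J$ or $Q^s\in J$; and it is called *radical* if it is equal to the intersection of all completely prime right ideals containing it. Let $\mathbb S=\{K\in\mathbb H: K^2=-1\}$ and $\mathbb C_K=\mathbb R+\mathbb R K$. For a right ideal $J$ let $$\mathcal V_c(J)=\{\mathbf a\in\mathbb H^n: P(\mathbf a)=0\ \text{for all } P\in J\}\cap\bigcup_{K\in\mathbb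 S}\mathbb C_K^n .$$ For $E\subseteq \bigcup_{K\in\mathbb S}\mathbb C_K^n$ let $$\mathbb S_E=\{(g^{-1}a_1g,\dots,g^{-1}a_ng):(a_1,\dots,a_n)\in E,\ g\in\mathbb H\setminus\{0\}\}.$$ A set of the form $\mathcal V_c(J)$, with $J$ a right ideal, is called *reducible* if it equals $\mathcal V_c(I_1)\cup\mathcal V_c(I_2)$ for two proper, nonzero right ideals $I_1,I_2$ such that $\mathcal V_c(I_1)\not\subseteq\mathcal V_c(I_2)$ and $\mathcal V_c(I_2)\not\subseteq\mathcal V_c(I_1)$; otherwise it is called *irreducible*. **Lemma.** Let $I$ be a right ideal of $\mathbb H[q_1,\dots,q_n]$ that is both radical and quasi prime. Then $\mathbb S_{\mathcal V_c(I)}$ is irreducible; that is, $\mathbb S_{\mathcal V_c(I)}=\mathcal V_c(J)$ for some right ideal $J$, and this set is not reducible. -/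

import Mathlib

open scoped Quaternion

noncomputable section

namespace SliceReg

/-- The ring `ℍ[q₁,…,qₙ]` of slice regular polynomials with the slice product `*`.
The element `single m a` is the monomial `q₁^{m₁} ⋯ qₙ^{mₙ} a`, and
`single m a * single l b = single (m + l) (a * b)`. -/
abbrev SlicePoly (n : ℕ) : Type := AddMonoidAlgebra ℍ[ℝ] (Fin n →₀ ℕ)

/-- Right ideals of `(ℍ[q₁,…,qₙ], +, *)`. -/
abbrev RightIdeal (n : ℕ) : Type := Submodule (SlicePoly n)ᵐᵒᵖ (SlicePoly n)

variable {n : ℕ}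

/-- The value at a point of `ℍⁿ` of the polynomial function
`(q₁,…,qₙ) ↦ ∑ q₁^{m₁} ⋯ qₙ^{mₙ} a_m`, the powers being multiplied in this order. -/
def eval (a : Fin n → ℍ[ℝ]) (P : SlicePoly n) : ℍ[ℝ] :=
  ∑ m ∈ P.coeff.support, (List.ofFn fun i => a i ^ m i).prod * P.coeff m

/-- The regular conjugate `P^c`: every coefficient is conjugated. -/
def conj (P : SlicePoly n) : SlicePoly n :=
  ∑ m ∈ P.coeff.support, AddMonoidAlgebra.single m (star (P.coeff m))

/-- The symmetrization `P^s = P * P^c` of a slice regular polynomial. -/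
def symm (P : SlicePoly n) : SlicePoly n := P * conj P

/-- `P * Q ∈ I` and `P * I ⊆ I` imply `P ∈ I` or `Q ∈ I`. -/
def IsCompletelyPrime (I : RightIdeal n) : Prop :=
  ∀ P Q : SlicePoly n, P * Q ∈ I → (∀ R ∈ I, P * R ∈ I) → P ∈ I ∨ Q ∈ I

/-- `P * Q ∈ I` implies `P ∈ I` or `Q^s ∈ I`. -/
def IsQuasiPrime (I : RightIdeal n) : Prop :=
  ∀ P Q : SlicePoly n, P * Q ∈ I → P ∈ I ∨ symm Q ∈ I

/-- The right radical: the intersection of all completely prime right ideals containing `I`. -/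
def rad (I : RightIdeal n) : RightIdeal n :=
  sInf {J | I ≤ J ∧ IsCompletelyPrime J}

/-- A right ideal is radical if it equals its right radical. -/
def IsRadical (I : RightIdeal n) : Prop := rad I = I

/-- The sphere `𝕊` of imaginary units. -/
def imagUnits : Set ℍ[ℝ] := {J | J ^ 2 = -1}

/-- The slice `ℂ_K = ℝ + ℝ K`. -/
def slice (K : ℍ[ℝ]) : Set ℍ[ℝ] := {q | ∃ x y : ℝ, q = (x : ℍ[ℝ]) + (y : ℍ[ℝ]) * K}

/-- `ℂ_Kⁿ ⊆ ℍⁿ`. -/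
def sliceN (n : ℕ) (K : ℍ[ℝ]) : Set (Fin n → ℍ[ℝ]) := {a | ∀ i, a i ∈ slice K}

/-- `𝒱(I)`, the common zeros in `ℍⁿ` of all polynomials of `I`. -/
def zeros (I : RightIdeal n) : Set (Fin n → ℍ[ℝ]) := {a | ∀ P ∈ I, eval a P = 0}

/-- `𝒱_c(I) = 𝒱(I) ∩ ⋃_{K ∈ 𝕊} ℂ_Kⁿ`. -/
def zerosC (I : RightIdeal n) : Set (Fin n → ℍ[ℝ]) :=
  zeros I ∩ ⋃ K ∈ imagUnits, sliceN n K

/-- The spherical set `𝕊_a` of a point: its simultaneous conjugates `(g⁻¹ a₁ g, …, g⁻¹ aₙ g)`. -/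
def sphericalSet (a : Fin n → ℍ[ℝ]) : Set (Fin n → ℍ[ℝ]) :=
  {b | ∃ g : ℍ[ℝ], g ≠ 0 ∧ b = fun i => g⁻¹ * a i * g}

/-- The symmetrization `𝕊_E = ⋃_{a ∈ E} 𝕊_a` of a set of points. -/
def symmSet (E : Set (Fin n → ℍ[ℝ])) : Set (Fin n → ℍ[ℝ]) := ⋃ a ∈ E, sphericalSet a

/-- A set is reducible if it is `𝒱_c(I₁) ∪ 𝒱_c(I₂)` for two proper nonzero right ideals whose
sets of zeros `𝒱_c(I₁)`, `𝒱_c(I₂)` are not contained one into the other. -/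
def IsReducible (V : Set (Fin n → ℍ[ℝ])) : Prop :=
  ∃ I₁ I₂ : RightIdeal n, I₁ ≠ ⊤ ∧ I₁ ≠ ⊥ ∧ I₂ ≠ ⊤ ∧ I₂ ≠ ⊥ ∧
    ¬ zerosC I₁ ⊆ zerosC I₂ ∧ ¬ zerosC I₂ ⊆ zerosC I₁ ∧ V = zerosC I₁ ∪ zerosC I₂

/-- An irreducible slice algebraic set: a set of the form `𝒱_c(J)` which is not reducible. -/
def IsIrreducible (V : Set (Fin n → ℍ[ℝ])) : Prop :=
  (∃ J : RightIdeal n, V = zerosC J) ∧ ¬ IsReducible V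

end SliceReg

end

open scoped Quaternion

noncomputable section

namespace SliceReg

open MvPolynomial

variable {n : ℕ}

/-! A slice polynomial is a quaternion over `ℝ[x]`, so a complex point `z` gives it a value `evalC z
P` in `ℍ[ℂ]`; its value at the copy of `z` in `ℂ_Kⁿ` is the real part plus `K` times the imaginary
part (`eval_point`). The real polynomials of `I` form an ideal `p`, prime or the unit ideal, and
`symmSet_zerosC` identifies the symmetrized zero set with all copies of the complex zeros of `p`,
which is also `zerosC (realSpan I)`.

If two zero sets make up this set, then over each `z` one of the two ideals vanishes at two copies
of `z`, hence is killed by `evalC z` (`evalC_eq_zero_of_subset_union`). The Nullstellensatz and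
primality put all components of one ideal in `p`, so its zero set contains the other. -/

/-! ### Slice polynomials as quaternions over real polynomials -/

/-- The quaternion with the given components. -/
def ofComponents {R : Type*} [CommRing R] (a b c d : R) : ℍ[R] := ⟨a, b, c, d⟩

section ofComponents

variable {R : Type*} [CommRing R] (a b c d : R)

@[simp] theorem re_ofComponents : (ofComponents a b c d).re = a := rfl
@[simp] theorem imI_ofComponents : (ofComponents a b c d).imI = b := rfl
@[simp] theorem imJ_ofComponents : (ofComponents a b c d).imJ = c := rfl
@[simp] theorem imK_ofComponents : (ofComponents a b c d).imK = d := rfl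

end ofComponents

/-- A ring homomorphism `f`, applied to the four components of quaternions. -/
def quatMap {R S : Type*} [CommRing R] [CommRing S] (f : R →+* S) : ℍ[R] →+* ℍ[S] where
  toFun q := ofComponents (f q.re) (f q.imI) (f q.imJ) (f q.imK)
  map_zero' := by ext <;> simp
  map_one' := by ext <;> simp
  map_add' p q := by ext <;> simp
  map_mul' p q := by ext <;> simp

theorem quatMap_apply {R S : Type*} [CommRing R] [CommRing S] (f : R →+* S) (q : ℍ[R]) :
    quatMap f q = ofComponents (f q.re) (f q.imI) (f q.imJ) (f q.imK) := rfl

theorem quatMap_algebraMap {R S : Type*} [CommRing R] [CommRing S] (f : R →+* S) (r : R) :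
    quatMap f (algebraMap R ℍ[R] r) = algebraMap S ℍ[S] (f r) := by
  ext <;> simp [quatMap_apply, Quaternion.algebraMap_def]

theorem star_sum_quaternion {R ι : Type*} [CommRing R] (s : Finset ι) (f : ι → ℍ[R]) :
    star (∑ i ∈ s, f i) = ∑ i ∈ s, star (f i) :=
  star_sum s f

/-- The monic monomials, as a submonoid of the centre of the quaternions over real polynomials. -/
def quatMonomial (n : ℕ) : Multiplicative (Fin n →₀ ℕ) →* ℍ[MvPolynomial (Fin n) ℝ] :=
  (algebraMap (MvPolynomial (Fin n) ℝ) ℍ[MvPolynomial (Fin n) ℝ]).toMonoidHom.comp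
    (monomialOneHom ℝ (Fin n))

theorem commute_quatMonomial (q : ℍ[MvPolynomial (Fin n) ℝ]) (m : Multiplicative (Fin n →₀ ℕ)) :
    Commute q (quatMonomial n m) :=
  (Algebra.commutes (R := MvPolynomial (Fin n) ℝ) (monomialOneHom ℝ (Fin n) m) q).symm

theorem quatMonomial_ofAdd (m : Fin n →₀ ℕ) :
    quatMonomial n (Multiplicative.ofAdd m) = ((monomial m 1 : MvPolynomial (Fin n) ℝ) :
      ℍ[MvPolynomial (Fin n) ℝ]) := rfl

/-- A slice regular polynomial as a quaternion with real polynomials as components. -/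
def toQuat : SlicePoly n →+* ℍ[MvPolynomial (Fin n) ℝ] :=
  AddMonoidAlgebra.liftNCRingHom (quatMap C) (quatMonomial n)
    (fun q m => commute_quatMonomial (quatMap C q) m)

theorem toQuat_single (m : Fin n →₀ ℕ) (q : ℍ[ℝ]) :
    toQuat (AddMonoidAlgebra.single m q) =
      ofComponents (monomial m q.re) (monomial m q.imI) (monomial m q.imJ) (monomial m q.imK) := by
  rw [toQuat, AddMonoidAlgebra.liftNCRingHom_single, quatMonomial_ofAdd]
  ext1 <;> simp [quatMap_apply, C_mul_monomial]

theorem coeff_toQuat (P : SlicePoly n) (m : Fin n →₀ ℕ) :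
    P.coeff m = ofComponents ((toQuat P).re.coeff m) ((toQuat P).imI.coeff m)
      ((toQuat P).imJ.coeff m) ((toQuat P).imK.coeff m) := by
  induction P using AddMonoidAlgebra.induction_linear with
  | zero => ext <;> simp
  | add P Q hP hQ =>
    rw [AddMonoidAlgebra.coeff_add, Finsupp.add_apply, hP, hQ]
    ext <;> simp
  | single l q =>
    rw [toQuat_single]
    by_cases h : l = m <;> ext <;> simp [coeff_monomial, h]

theorem toQuat_injective : Function.Injective (toQuat (n := n)) := by
  intro P Q h
  ext1
  ext1 m
  rw [coeff_toQuat, coeff_toQuat, h]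

/-- Real polynomials, as slice regular polynomials with real coefficients. -/
def central : MvPolynomial (Fin n) ℝ →+* SlicePoly n :=
  AddMonoidAlgebra.mapRingHom (Fin n →₀ ℕ) (algebraMap ℝ ℍ[ℝ])

theorem toQuat_central (f : MvPolynomial (Fin n) ℝ) :
    toQuat (central f) = algebraMap _ _ f := by
  induction f using MvPolynomial.induction_on' with
  | monomial m r =>
    have : central (monomial m r) = AddMonoidAlgebra.single m (algebraMap ℝ ℍ[ℝ] r) :=
      AddMonoidAlgebra.mapRingHom_single _ _ _
    rw [this, toQuat_single]
    ext1 <;> simp [Quaternion.algebraMap_def]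
  | add f g hf hg => rw [map_add, map_add, map_add, hf, hg]

theorem toQuat_conj (P : SlicePoly n) : toQuat (conj P) = star (toQuat P) := by
  have h : conj P = ∑ m ∈ P.coeff.support, AddMonoidAlgebra.single m (star (P.coeff m)) := rfl
  have h' : P = ∑ m ∈ P.coeff.support, AddMonoidAlgebra.single m (P.coeff m) := by
    conv_lhs => rw [← AddMonoidAlgebra.sum_coeff_single P]
    rfl
  conv_rhs => rw [h', map_sum, star_sum_quaternion]
  rw [h, map_sum]
  refine Finset.sum_congr rfl fun m _ => ?_
  rw [toQuat_single, toQuat_single]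
  ext1 <;> simp

theorem symm_eq_central (P : SlicePoly n) :
    symm P = central (Quaternion.normSq (toQuat P)) := by
  apply toQuat_injective
  rw [symm, map_mul, toQuat_conj, toQuat_central, Quaternion.self_mul_star]
  rfl

theorem symm_central (f : MvPolynomial (Fin n) ℝ) : symm (central f) = central (f * f) := by
  rw [symm_eq_central, toQuat_central, Quaternion.algebraMap_def, Quaternion.normSq_coe, sq]

theorem central_comm (f : MvPolynomial (Fin n) ℝ) (P : SlicePoly n) :
    central f * P = P * central f := by
  apply toQuat_injective
  rw [map_mul, map_mul, toQuat_central, Algebra.commutes]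

/-! ### Values at complex points -/

/-- The components of a slice regular polynomial, evaluated at a complex point. -/
def evalC (z : Fin n → ℂ) : SlicePoly n →+* ℍ[ℂ] := (quatMap (aeval z).toRingHom).comp toQuat

theorem evalC_central (z : Fin n → ℂ) (f : MvPolynomial (Fin n) ℝ) :
    evalC z (central f) = algebraMap ℂ ℍ[ℂ] (aeval z f) := by
  rw [evalC, RingHom.comp_apply, toQuat_central, quatMap_algebraMap]
  rfl

theorem aeval_normSq (z : Fin n → ℂ) (P : SlicePoly n) :
    aeval z (Quaternion.normSq (toQuat P)) = Quaternion.normSq (evalC z P) := by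
  simp [Quaternion.normSq_def', evalC, quatMap_apply]

theorem evalC_C (z : Fin n → ℂ) (q : ℍ[ℝ]) :
    evalC z (AddMonoidAlgebra.single 0 q) = ofComponents (q.re : ℂ) q.imI q.imJ q.imK := by
  rw [evalC, RingHom.comp_apply, toQuat_single]
  ext1 <;> simp [quatMap_apply]

theorem evalC_eq_zero (z : Fin n → ℂ) (P : SlicePoly n) : evalC z P = 0 ↔
    aeval z (toQuat P).re = 0 ∧ aeval z (toQuat P).imI = 0 ∧
      aeval z (toQuat P).imJ = 0 ∧ aeval z (toQuat P).imK = 0 := by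
  simp [Quaternion.ext_iff, evalC, quatMap_apply]

/-- The real part of a complexified quaternion. -/
def rePart : ℍ[ℂ] →+ ℍ[ℝ] where
  toFun q := ofComponents q.re.re q.imI.re q.imJ.re q.imK.re
  map_zero' := by ext <;> simp
  map_add' p q := by ext <;> simp

/-- The imaginary part of a complexified quaternion. -/
def imPart : ℍ[ℂ] →+ ℍ[ℝ] where
  toFun q := ofComponents q.re.im q.imI.im q.imJ.im q.imK.im
  map_zero' := by ext <;> simp
  map_add' p q := by ext <;> simp

section parts

variable (q : ℍ[ℂ])

@[simp] theorem re_rePart : (rePart q).re = q.re.re := rfl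
@[simp] theorem imI_rePart : (rePart q).imI = q.imI.re := rfl
@[simp] theorem imJ_rePart : (rePart q).imJ = q.imJ.re := rfl
@[simp] theorem imK_rePart : (rePart q).imK = q.imK.re := rfl
@[simp] theorem re_imPart : (imPart q).re = q.re.im := rfl
@[simp] theorem imI_imPart : (imPart q).imI = q.imI.im := rfl
@[simp] theorem imJ_imPart : (imPart q).imJ = q.imJ.im := rfl
@[simp] theorem imK_imPart : (imPart q).imK = q.imK.im := rfl

end parts

theorem rePart_mul (p q : ℍ[ℂ]) :
    rePart (p * q) = rePart p * rePart q - imPart p * imPart q := by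
  ext <;> simp <;> ring

theorem imPart_mul (p q : ℍ[ℂ]) :
    imPart (p * q) = rePart p * imPart q + imPart p * rePart q := by
  ext <;> simp <;> ring

theorem eq_zero_of_parts {q : ℍ[ℂ]} (hr : rePart q = 0) (hi : imPart q = 0) : q = 0 := by
  rw [Quaternion.ext_iff] at hr hi
  obtain ⟨a, b, c, d⟩ := hr
  obtain ⟨a', b', c', d'⟩ := hi
  ext1 <;> apply Complex.ext <;> assumption

/-- The copy in `ℂ_Kⁿ` of a complex point. -/
def point (K : ℍ[ℝ]) (z : Fin n → ℂ) : Fin n → ℍ[ℝ] :=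
  fun i => ((z i).re : ℍ[ℝ]) + ((z i).im : ℍ[ℝ]) * K

theorem eval_add (a : Fin n → ℍ[ℝ]) (P Q : SlicePoly n) :
    eval a (P + Q) = eval a P + eval a Q := by
  have h (P : SlicePoly n) : eval a P =
      P.coeff.sum fun m q => (List.ofFn fun i => a i ^ m i).prod * q := rfl
  rw [h, h, h, AddMonoidAlgebra.coeff_add]
  exact Finsupp.sum_add_index' (fun _ => mul_zero _) (fun _ _ _ => mul_add _ _ _)

theorem eval_single (a : Fin n → ℍ[ℝ]) (m : Fin n →₀ ℕ) (q : ℍ[ℝ]) :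
    eval a (AddMonoidAlgebra.single m q) = (List.ofFn fun i => a i ^ m i).prod * q := by
  have h (P : SlicePoly n) : eval a P =
      P.coeff.sum fun m q => (List.ofFn fun i => a i ^ m i).prod * q := rfl
  rw [h, AddMonoidAlgebra.coeff_single]
  exact Finsupp.sum_single_index (mul_zero _)

/-- The coordinates of a point of `ℂ_Kⁿ` commute: the ordered product of powers is the image of a
complex monomial under the embedding `ℂ → ℍ` sending the imaginary unit to `K`. -/
theorem eval_point {K : ℍ[ℝ]} (hK : K * K = -1) (z : Fin n → ℂ) (P : SlicePoly n) :
    eval (point K z) P = rePart (evalC z P) + K * imPart (evalC z P) := by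
  induction P using AddMonoidAlgebra.induction_linear with
  | zero => simp [eval]
  | add P Q hP hQ =>
    rw [eval_add, hP, hQ, map_add, map_add, map_add, mul_add]
    abel
  | single m q =>
    set φ : ℂ →ₐ[ℝ] ℍ[ℝ] := Complex.lift ⟨K, hK⟩ with hφ
    have hφ_apply (w : ℂ) : φ w = (w.re : ℍ[ℝ]) + (w.im : ℍ[ℝ]) * K := by
      rw [hφ, Complex.lift_apply, Complex.liftAux_apply]
      simp [Quaternion.algebraMap_def, ← Quaternion.coe_mul_eq_smul]
    have hprod : (List.ofFn fun i => point K z i ^ m i).prod = φ (∏ i, z i ^ m i) := by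
      rw [← List.prod_ofFn, map_list_prod, List.map_ofFn]
      congr 2
      funext i
      simp [point, ← hφ_apply]
    have hcomm (x : ℝ) : (x : ℍ[ℝ]) * K = K * (x : ℍ[ℝ]) := Quaternion.coe_commutes x K
    set w := ∏ i, z i ^ m i with hw
    have h : evalC z (AddMonoidAlgebra.single m q) =
        ofComponents (w * q.re) (w * q.imI) (w * q.imJ) (w * q.imK) := by
      rw [evalC, RingHom.comp_apply, toQuat_single]
      ext1 <;> simp [quatMap_apply, aeval_monomial, Finsupp.prod_fintype, hw, mul_comm]
    have h1 : rePart (evalC z (AddMonoidAlgebra.single m q)) = (w.re : ℍ[ℝ]) * q := by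
      rw [h]
      ext <;> simp
    have h2 : imPart (evalC z (AddMonoidAlgebra.single m q)) = (w.im : ℍ[ℝ]) * q := by
      rw [h]
      ext <;> simp
    rw [eval_single, hprod, hφ_apply, h1, h2, hcomm, add_mul, mul_assoc]

theorem mul_mem_right {I : RightIdeal n} {P : SlicePoly n} (hP : P ∈ I) (Q : SlicePoly n) :
    P * Q ∈ I :=
  I.smul_mem (MulOpposite.op Q) hP

/-! ### The ideal of real polynomials -/

/-- The real polynomials in a right ideal. -/
def realIdeal (I : RightIdeal n) : Ideal (MvPolynomial (Fin n) ℝ) where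
  carrier := {f | central f ∈ I}
  zero_mem' := by simp
  add_mem' {f g} hf hg := by
    rw [Set.mem_ofPred_eq, map_add]
    exact I.add_mem hf hg
  smul_mem' f g hg := by
    rw [Set.mem_ofPred_eq, smul_eq_mul, map_mul, central_comm]
    exact mul_mem_right hg _

theorem mem_realIdeal {I : RightIdeal n} {f : MvPolynomial (Fin n) ℝ} :
    f ∈ realIdeal I ↔ central f ∈ I := Iff.rfl

/-- Since `central f` commutes with everything, it maps every right ideal into itself, so complete
primeness applies to its square. -/
theorem IsRadical.mem_of_mul_self {I : RightIdeal n} (hrad : IsRadical I)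
    {f : MvPolynomial (Fin n) ℝ} (hf : central (f * f) ∈ I) : central f ∈ I := by
  rw [← hrad, rad, Submodule.mem_sInf]
  rintro J ⟨hIJ, hJ⟩
  have h : central f * central f ∈ J := by
    rw [← map_mul]
    exact hIJ hf
  refine (hJ _ _ h fun R hR => ?_).elim id id
  rw [central_comm]
  exact mul_mem_right hR _

/-- The symmetrization of a real `g` is `g * g`, and radicality removes the square. -/
theorem isPrime_realIdeal {I : RightIdeal n} (hrad : IsRadical I) (hqp : IsQuasiPrime I)
    (h : realIdeal I ≠ ⊤) : (realIdeal I).IsPrime := by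
  refine ⟨h, fun {f g} hfg => ?_⟩
  rw [mem_realIdeal, map_mul] at hfg
  refine (hqp _ _ hfg).imp id fun hg => ?_
  rw [symm_central] at hg
  exact hrad.mem_of_mul_self hg

/-! ### Zero sets and their symmetrization -/

theorem mem_zerosC_iff {I : RightIdeal n} {a : Fin n → ℍ[ℝ]} : a ∈ zerosC I ↔
    ∃ (K : ℍ[ℝ]) (z : Fin n → ℂ), K * K = -1 ∧ a = point K z ∧
      ∀ P ∈ I, rePart (evalC z P) + K * imPart (evalC z P) = 0 := by
  constructor
  · rintro ⟨h0, hs⟩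
    obtain ⟨K, hK, ha⟩ := Set.mem_iUnion₂.mp hs
    have hK' : K * K = -1 := by
      rw [← sq]
      exact hK
    choose x y hxy using ha
    have hp : a = point K fun i => ⟨x i, y i⟩ := funext hxy
    refine ⟨K, _, hK', hp, fun P hP => ?_⟩
    rw [← eval_point hK', ← hp]
    exact h0 P hP
  · rintro ⟨K, z, hK, rfl, h⟩
    refine ⟨fun P hP => ?_, Set.mem_iUnion₂.mpr ⟨K, ?_, fun i => ⟨_, _, rfl⟩⟩⟩
    · rw [eval_point hK, h P hP]
    · change K ^ 2 = -1
      rw [sq, hK]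

theorem conj_mul_self {K g : ℍ[ℝ]} (hK : K * K = -1) (hg : g ≠ 0) :
    (g⁻¹ * K * g) * (g⁻¹ * K * g) = -1 := by
  calc (g⁻¹ * K * g) * (g⁻¹ * K * g) = g⁻¹ * K * (g * g⁻¹) * K * g := by noncomm_ring
    _ = g⁻¹ * (K * K) * g := by rw [mul_inv_cancel₀ hg]; noncomm_ring
    _ = -(g⁻¹ * g) := by rw [hK]; noncomm_ring
    _ = -1 := by rw [inv_mul_cancel₀ hg]

theorem point_conj {K g : ℍ[ℝ]} (hg : g ≠ 0) (z : Fin n → ℂ) :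
    point (g⁻¹ * K * g) z = fun i => g⁻¹ * point K z i * g := by
  funext i
  simp only [point]
  rw [mul_add, add_mul, ← Quaternion.coe_commutes (z i).re, mul_assoc ((z i).re : ℍ[ℝ]),
    inv_mul_cancel₀ hg, mul_one]
  congr 1
  rw [← mul_assoc g⁻¹, ← Quaternion.coe_commutes (z i).im g⁻¹]
  noncomm_ring

/-- `ℍ` is a right `ℍ[ℂ]`-module under `h · u = h * rePart u + K * h * imPart u`. It is faithful, so
some `g = h · u` is nonzero; then `g · p = h · (u * p) = 0`, and it remains to multiply by `g⁻¹` on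
the left. -/
theorem exists_forall_annihilated_vanish {K : ℍ[ℝ]} (hK : K * K = -1) {u : ℍ[ℂ]} (hu : u ≠ 0) :
    ∃ g : ℍ[ℝ], g ≠ 0 ∧
      ∀ p : ℍ[ℂ], u * p = 0 → rePart p + (g⁻¹ * K * g) * imPart p = 0 := by
  obtain ⟨h, hg⟩ : ∃ h : ℍ[ℝ], h * rePart u + K * h * imPart u ≠ 0 := by
    by_contra! H
    have hre : rePart u = -(K * imPart u) := by
      have := H 1
      rw [one_mul, mul_one] at this
      exact eq_neg_of_add_eq_zero_left this
    have him : imPart u = 0 := by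
      by_contra h0
      have hc (h : ℍ[ℝ]) : K * h = h * K := by
        have h1 := H h
        rw [hre] at h1
        have h2 : (K * h - h * K) * imPart u = 0 := by
          rw [← h1]
          noncomm_ring
        exact sub_eq_zero.mp ((mul_eq_zero.mp h2).resolve_right h0)
      -- Commuting with `i` and `j` makes `K` real, against `K * K = -1`.
      have hi := Quaternion.ext_iff.mp (hc (ofComponents 0 1 0 0))
      have hj := Quaternion.ext_iff.mp (hc (ofComponents 0 0 1 0))
      have hr := congrArg (fun q : ℍ[ℝ] => q.re) hK
      simp at hi hj hr
      nlinarith [hi.1, hi.2, hj.1, hj.2, sq_nonneg K.re]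
    refine hu (eq_zero_of_parts ?_ him)
    rw [hre, him, mul_zero, neg_zero]
  refine ⟨_, hg, fun p hp => ?_⟩
  set g := h * rePart u + K * h * imPart u with hgdef
  have h1 : rePart u * rePart p - imPart u * imPart p = 0 := by
    rw [← rePart_mul, hp, map_zero]
  have h2 : rePart u * imPart p + imPart u * rePart p = 0 := by
    rw [← imPart_mul, hp, map_zero]
  have h3 : g * rePart p + K * g * imPart p = 0 := by
    calc g * rePart p + K * g * imPart p
        = h * (rePart u * rePart p) + (K * K) * h * (imPart u * imPart p)
          + K * h * (rePart u * imPart p + imPart u * rePart p) := by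
          rw [hgdef]
          noncomm_ring
      _ = h * (rePart u * rePart p - imPart u * imPart p) := by
          rw [hK, h2]
          noncomm_ring
      _ = 0 := by rw [h1, mul_zero]
  calc rePart p + g⁻¹ * K * g * imPart p
      = (g⁻¹ * g) * rePart p + g⁻¹ * K * g * imPart p := by rw [inv_mul_cancel₀ hg, one_mul]
    _ = g⁻¹ * (g * rePart p + K * g * imPart p) := by noncomm_ring
    _ = 0 := by rw [h3, mul_zero]

/-- Polarization: the multipliers `1, i, j, k` isolate the four components of `star q * p`. -/
theorem star_mul_eq_zero_of_normSq {p q : ℍ[ℂ]} (hp : Quaternion.normSq p = 0)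
    (hq : Quaternion.normSq q = 0)
    (h : ∀ a b c d : ℝ, Quaternion.normSq (p + q * ofComponents (a : ℂ) b c d) = 0) :
    star q * p = 0 := by
  have h1 := h 1 0 0 0
  have h2 := h 0 1 0 0
  have h3 := h 0 0 1 0
  have h4 := h 0 0 0 1
  rw [Quaternion.normSq_def'] at hp hq h1 h2 h3 h4
  simp at h1 h2 h3 h4
  ext
  · simp
    linear_combination (h1 - hp - hq) / 2
  · simp
    linear_combination (h2 - hp - hq) / 2
  · simp
    linear_combination (h3 - hp - hq) / 2
  · simp
    linear_combination (h4 - hp - hq) / 2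

theorem eq_zero_of_real_parts {K : ℍ[ℝ]} (hK : K * K = -1) {w : ℂ}
    (h : rePart (algebraMap ℂ ℍ[ℂ] w) + K * imPart (algebraMap ℂ ℍ[ℂ] w) = 0) : w = 0 := by
  have h1 := congrArg (fun q : ℍ[ℝ] => q.re) hK
  have h2 := Quaternion.ext_iff.mp h
  simp [Quaternion.algebraMap_def] at h1 h2
  obtain ⟨ha, hb⟩ := h2
  have him : w.im = 0 := by
    by_contra h0
    simp [h0] at hb
    obtain ⟨hi, hj, hk⟩ := hb
    rw [hi, hj, hk] at h1
    nlinarith [sq_nonneg K.re]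
  rw [him, mul_zero, add_zero] at ha
  exact Complex.ext ha him

/-- For the harder inclusion, `P^s` is real and lies in `I`, so at a zero `z` of the real ideal the
values of `I` have norm zero, and by polarization `star (evalC z Q)` annihilates them all. One
nonzero value therefore yields a single conjugate of `K` at which all of `I` vanishes. -/
theorem symmSet_zerosC (I : RightIdeal n) : symmSet (zerosC I) =
    {a | ∃ (K : ℍ[ℝ]) (z : Fin n → ℂ), K * K = -1 ∧ a = point K z ∧
      z ∈ zeroLocus ℂ (realIdeal I)} := by
  ext b
  simp only [symmSet, Set.mem_iUnion, Set.mem_ofPred_eq, exists_prop]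
  constructor
  · rintro ⟨a, ha, g, hg, rfl⟩
    obtain ⟨K, z, hK, rfl, h⟩ := mem_zerosC_iff.mp ha
    refine ⟨_, z, conj_mul_self hK hg, (point_conj hg z).symm, fun f hf => ?_⟩
    by_contra h0
    have h1 := h _ hf
    rw [evalC_central] at h1
    exact h0 (eq_zero_of_real_parts hK h1)
  · rintro ⟨K, z, hK, rfl, hz⟩
    have hnorm (P) (hP : P ∈ I) : Quaternion.normSq (evalC z P) = 0 := by
      rw [← aeval_normSq]
      apply hz
      rw [mem_realIdeal, ← symm_eq_central]
      exact mul_mem_right hP _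
    have hstar (P) (hP : P ∈ I) (Q) (hQ : Q ∈ I) : star (evalC z Q) * evalC z P = 0 := by
      refine star_mul_eq_zero_of_normSq (hnorm P hP) (hnorm Q hQ) fun a b c d => ?_
      have := hnorm _ (I.add_mem hP (mul_mem_right hQ
        (AddMonoidAlgebra.single 0 (ofComponents a b c d))))
      rwa [map_add, map_mul, evalC_C] at this
    obtain ⟨g, hg, h⟩ : ∃ g : ℍ[ℝ], g ≠ 0 ∧ ∀ P ∈ I,
        rePart (evalC z P) + (g⁻¹ * K * g) * imPart (evalC z P) = 0 := by
      by_cases hI : ∀ Q ∈ I, evalC z Q = 0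
      · exact ⟨1, one_ne_zero, fun P hP => by simp [hI P hP]⟩
      · push Not at hI
        obtain ⟨Q, hQ, h0⟩ := hI
        obtain ⟨g, hg, h⟩ := exists_forall_annihilated_vanish hK (star_ne_zero.mpr h0)
        exact ⟨g, hg, fun P hP => h _ (hstar P hP Q hQ)⟩
    -- Conjugating by `g⁻¹` carries `g⁻¹ * K * g` back to `K`.
    refine ⟨_, mem_zerosC_iff.mpr ⟨_, z, conj_mul_self hK hg, rfl, h⟩, g⁻¹, inv_ne_zero hg, ?_⟩
    rw [← point_conj (inv_ne_zero hg)]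
    congr 1
    rw [inv_inv, mul_assoc g⁻¹, mul_inv_cancel_left₀ hg, mul_assoc, mul_inv_cancel₀ hg, mul_one]

/-- The right ideal generated by the real polynomials of `I`. -/
def realSpan (I : RightIdeal n) : RightIdeal n :=
  Submodule.span _ (central '' (realIdeal I : Set (MvPolynomial (Fin n) ℝ)))

theorem zerosC_realSpan (I : RightIdeal n) : zerosC (realSpan I) =
    {a | ∃ (K : ℍ[ℝ]) (z : Fin n → ℂ), K * K = -1 ∧ a = point K z ∧
      z ∈ zeroLocus ℂ (realIdeal I)} := by
  ext a
  rw [mem_zerosC_iff, Set.mem_ofPred_eq]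
  refine exists_congr fun K => exists_congr fun z => and_congr_right fun hK =>
    and_congr_right fun _ => ⟨fun h f hf => ?_, fun h P hP => ?_⟩
  · have h1 := h _ (Submodule.subset_span ⟨f, hf, rfl⟩)
    rw [evalC_central] at h1
    exact eq_zero_of_real_parts hK h1
  · have : evalC z P = 0 := by
      refine Submodule.span_induction ?_ (map_zero _) (fun P Q _ _ hP hQ => ?_)
        (fun Q P _ hP => ?_) hP
      · rintro _ ⟨f, hf, rfl⟩
        rw [evalC_central, h f hf, map_zero]
      · rw [map_add, hP, hQ, add_zero]
      · rw [← MulOpposite.op_unop Q, op_smul_eq_mul, map_mul, hP, zero_mul]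
    rw [this, map_zero, map_zero, mul_zero, add_zero]

/-! ### Irreducibility -/

theorem eq_zero_of_ne {K L : ℍ[ℝ]} (hKL : K ≠ L) {p : ℍ[ℂ]}
    (hK : rePart p + K * imPart p = 0) (hL : rePart p + L * imPart p = 0) : p = 0 := by
  have h : (K - L) * imPart p = 0 := by
    rw [sub_mul, sub_eq_zero]
    exact add_left_cancel (hK.trans hL.symm)
  have him := (mul_eq_zero.mp h).resolve_left (sub_ne_zero.mpr hKL)
  rw [him, mul_zero, add_zero] at hK
  exact eq_zero_of_parts hK him

theorem eval_point_eq_zero {I : RightIdeal n} {K : ℍ[ℝ]} (hK : K * K = -1) {z : Fin n → ℂ}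
    (h : point K z ∈ zerosC I) {P : SlicePoly n} (hP : P ∈ I) :
    rePart (evalC z P) + K * imPart (evalC z P) = 0 := by
  rw [← eval_point hK]
  exact h.1 P hP

/-- Pigeonhole: two of the units `i, j, k` fall to the same ideal, and vanishing for two distinct
units forces the value in `ℍ[ℂ]` to be zero. -/
theorem evalC_eq_zero_of_subset_union {I₁ I₂ : RightIdeal n} {z : Fin n → ℂ}
    (h : ∀ K : ℍ[ℝ], K * K = -1 → point K z ∈ zerosC I₁ ∪ zerosC I₂) :
    (∀ P ∈ I₁, evalC z P = 0) ∨ (∀ P ∈ I₂, evalC z P = 0) := by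
  set i : ℍ[ℝ] := ofComponents 0 1 0 0
  set j : ℍ[ℝ] := ofComponents 0 0 1 0
  set k : ℍ[ℝ] := ofComponents 0 0 0 1
  have hi : i * i = -1 := by ext <;> simp [i]
  have hj : j * j = -1 := by ext <;> simp [j]
  have hk : k * k = -1 := by ext <;> simp [k]
  have hij : i ≠ j := fun h => by simpa [i, j] using congrArg (fun q : ℍ[ℝ] => q.imI) h
  have hik : i ≠ k := fun h => by simpa [i, k] using congrArg (fun q : ℍ[ℝ] => q.imI) h
  have hjk : j ≠ k := fun h => by simpa [j, k] using congrArg (fun q : ℍ[ℝ] => q.imJ) h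
  have key (J : RightIdeal n) {K L : ℍ[ℝ]} (hK : K * K = -1) (hL : L * L = -1) (hKL : K ≠ L)
      (h1 : point K z ∈ zerosC J) (h2 : point L z ∈ zerosC J) : ∀ P ∈ J, evalC z P = 0 :=
    fun P hP => eq_zero_of_ne hKL (eval_point_eq_zero hK h1 hP) (eval_point_eq_zero hL h2 hP)
  rcases h i hi with h1 | h1 <;> rcases h j hj with h2 | h2 <;> rcases h k hk with h3 | h3
  · exact Or.inl (key _ hi hj hij h1 h2)
  · exact Or.inl (key _ hi hj hij h1 h2)
  · exact Or.inl (key _ hi hk hik h1 h3)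
  · exact Or.inr (key _ hj hk hjk h2 h3)
  · exact Or.inl (key _ hj hk hjk h2 h3)
  · exact Or.inr (key _ hi hk hik h1 h3)
  · exact Or.inr (key _ hi hj hij h1 h2)
  · exact Or.inr (key _ hi hj hij h1 h2)

/-- The real polynomials that are components of elements of `I`. -/
def components (I : RightIdeal n) : Set (MvPolynomial (Fin n) ℝ) :=
  {f | ∃ P ∈ I, f = (toQuat P).re ∨ f = (toQuat P).imI ∨ f = (toQuat P).imJ ∨ f = (toQuat P).imK}

theorem forall_evalC_eq_zero_iff {I : RightIdeal n} {z : Fin n → ℂ} :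
    (∀ P ∈ I, evalC z P = 0) ↔ ∀ f ∈ components I, aeval z f = 0 := by
  constructor
  · rintro h f ⟨P, hP, hf⟩
    obtain ⟨h1, h2, h3, h4⟩ := (evalC_eq_zero z P).mp (h P hP)
    rcases hf with rfl | rfl | rfl | rfl <;> assumption
  · intro h P hP
    exact (evalC_eq_zero z P).mpr ⟨h _ ⟨P, hP, Or.inl rfl⟩, h _ ⟨P, hP, Or.inr (Or.inl rfl)⟩,
      h _ ⟨P, hP, Or.inr (Or.inr (Or.inl rfl))⟩, h _ ⟨P, hP, Or.inr (Or.inr (Or.inr rfl))⟩⟩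

/-- For `f ∈ S` and `g ∈ T` outside `p`, the product `f * g` vanishes on the complex zeros of `p`,
so it lies in `p` by the Nullstellensatz. -/
theorem subset_or_subset_of_cover {p : Ideal (MvPolynomial (Fin n) ℝ)} (hp : p.IsPrime)
    {S T : Set (MvPolynomial (Fin n) ℝ)}
    (h : ∀ z ∈ zeroLocus ℂ p, (∀ f ∈ S, aeval z f = 0) ∨ (∀ g ∈ T, aeval z g = 0)) :
    S ⊆ p ∨ T ⊆ p := by
  by_contra! H
  obtain ⟨f, hf, hfp⟩ := Set.not_subset.mp H.1
  obtain ⟨g, hg, hgp⟩ := Set.not_subset.mp H.2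
  have : f * g ∈ p := by
    rw [← IsPrime.vanishingIdeal_zeroLocus (K := ℂ) p]
    intro z hz
    rw [map_mul]
    rcases h z hz with h1 | h1
    · rw [h1 f hf, zero_mul]
    · rw [h1 g hg, mul_zero]
  exact (hp.mem_or_mem this).elim hfp hgp

theorem symmSet_subset_of_components {I J : RightIdeal n}
    (h : components J ⊆ realIdeal I) : symmSet (zerosC I) ⊆ zerosC J := by
  rw [symmSet_zerosC]
  rintro _ ⟨K, z, hK, rfl, hz⟩
  refine mem_zerosC_iff.mpr ⟨K, z, hK, rfl, fun P hP => ?_⟩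
  rw [forall_evalC_eq_zero_iff.mpr (fun f hf => hz f (h hf)) P hP, map_zero, map_zero, mul_zero,
    add_zero]

theorem not_isReducible_symmSet {I : RightIdeal n} (hrad : IsRadical I) (hqp : IsQuasiPrime I) :
    ¬ IsReducible (symmSet (zerosC I)) := by
  rintro ⟨I₁, I₂, -, -, -, -, h12, h21, hV⟩
  have hcover : ∀ z ∈ zeroLocus ℂ (realIdeal I), (∀ P ∈ I₁, evalC z P = 0) ∨
      (∀ P ∈ I₂, evalC z P = 0) := by
    refine fun z hz => evalC_eq_zero_of_subset_union fun K hK => ?_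
    rw [← hV, symmSet_zerosC]
    exact ⟨K, z, hK, rfl, hz⟩
  simp only [forall_evalC_eq_zero_iff] at hcover
  have hsub : components I₁ ⊆ realIdeal I ∨ components I₂ ⊆ realIdeal I := by
    -- The unit ideal is not prime, but it contains all components.
    by_cases htop : realIdeal I = ⊤
    · left
      rw [htop]
      exact Set.subset_univ _
    · exact subset_or_subset_of_cover (isPrime_realIdeal hrad hqp htop) hcover
  rcases hsub with h | h
  · refine h21 ((Set.subset_union_right.trans hV.symm.subset).trans ?_)
    exact symmSet_subset_of_components h
  · refine h12 ((Set.subset_union_left.trans hV.symm.subset).trans ?_)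
    exact symmSet_subset_of_components h

end SliceReg

end

theorem lemma3p1 (n : ℕ) (I : SliceReg.RightIdeal n)
    (hrad : SliceReg.IsRadical I) (hqp : SliceReg.IsQuasiPrime I) :
    SliceReg.IsIrreducible (SliceReg.symmSet (SliceReg.zerosC I)) :=
  ⟨⟨SliceReg.realSpan I, (SliceReg.symmSet_zerosC I).trans (SliceReg.zerosC_realSpan I).symm⟩,
    SliceReg.not_isReducible_symmSet hrad hqp⟩
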